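/- Let $n\ge 2$. For a locally biholomorphic map $f=(f_1,\dots,f_n)$ from an open subset of $\mathbb C^n$ to $\mathbb C^n$ let $J_f=\det Df$ and, for $1\le i,j,k\le n$, $$S^k_{ij}f=\sum_{l=1}^n\frac{\partial^2 f_l}{\partial z_i\partial z_j}\,\frac{\partial z_k}{\partial f_l}-\frac1{n+1}\Bigl(\delta^k_i\frac{\partial}{\partial z_j}+\delta^k_j\frac{\partial}{\partial z_i}\Bigr)\log J_f ,$$ where $(\partial z_k/\partial f_l)_{k,l}=(Df)^{-1}$. Let $S_f(z)(v)\in\mathbb C^n$ be the vector with components $\sum_{i,j}v_i\,S^k_{ij}f(z)\,v_j$, $k=1,\dots,n$. For $z$ in the unit polydisk and $v\in\mathbb C^n$ let $$\|v\|_z=\Bigl(2\sum_{i=1}^n\frac{|v_i|^2}{(1-|z_i|^2)^2}\Bigr)^{1/2}$$ be the Bergman norm of $v$ at $z$, and let $|z|_\infty=\max_i|z_i|$. For $0<r<1$ and $\alpha>0$ let $\mathcal F_{\alpha,r}$ be the class of all maps $f$ that are locally biholomorphic on $\{|z|_\infty<r\}$ with $f(0)=0$, $Df(0)=I$ and $$\sup_{|z|_\infty<r}\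 \sup_{\|v\|_z=1}\|S_f(z)(v)\|_z\le\alpha ,$$ and let $$\mu_r(\alpha)=\sup_{f\in\mathcal F_{\alpha,r}}|\nabla J_f(0)| ,$$ where $|\cdot|$ is the Euclidean norm and $\nabla J_f=(\partial J_f/\partial z_1,\dots,\partial J_f/\partial z_n)$. **Theorem 4.1.** Suppose $0<r$ and $r^2<1/5$. Then $\mu_r(\alpha)<\infty$ for every $\alpha>0$, the function $\mu_r$ is locally Lipschitz on $(0,\infty)$, and at every $\alpha>0$ at which $\mu_r$ is differentiable, $$\alpha\,\mu_r'(\alpha)\le\frac{1-r^2}{1-5r^2}\,\mu_r(\alpha).$$ -/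

import Mathlib

noncomputable section

namespace PolydiskSchwarzian

/-- The complex partial derivative `∂g/∂z_i` at `z`. -/
def pderiv {n : ℕ} (i : Fin n) (g : (Fin n → ℂ) → ℂ) (z : Fin n → ℂ) : ℂ :=
  fderiv ℂ g z (Pi.single i 1)

/-- The Jacobian matrix `(∂f_l/∂z_i)_{l,i}` of `f` at `z`. -/
def jacobianMatrix {n : ℕ} (f : (Fin n → ℂ) → (Fin n → ℂ)) (z : Fin n → ℂ) :
    Matrix (Fin n) (Fin n) ℂ :=
  Matrix.of fun l i => pderiv i (fun w => f w l) z

/-- The complex Jacobian `J_f = det Df`. -/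
def jacobian {n : ℕ} (f : (Fin n → ℂ) → (Fin n → ℂ)) (z : Fin n → ℂ) : ℂ :=
  (jacobianMatrix f z).det

/-- The open polydisk `|z|_∞ < r`. -/
def polydisk (n : ℕ) (r : ℝ) : Set (Fin n → ℂ) :=
  {z | ∀ i, ‖z i‖ < r}

/-- `f` is holomorphic on `Ω` with nowhere vanishing Jacobian, that is (for open `Ω`), `f` is
locally biholomorphic on `Ω`. -/
def IsLocallyBiholomorphicOn {n : ℕ} (f : (Fin n → ℂ) → (Fin n → ℂ))
    (Ω : Set (Fin n → ℂ)) : Prop :=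
  AnalyticOnNhd ℂ f Ω ∧ ∀ z ∈ Ω, jacobian f z ≠ 0

/-- The logarithmic derivative `∂/∂z_i log J_f = (∂J_f/∂z_i) / J_f` (independent of the choice
of a local branch of the logarithm). -/
def logJacobianDeriv {n : ℕ} (f : (Fin n → ℂ) → (Fin n → ℂ)) (i : Fin n) (z : Fin n → ℂ) : ℂ :=
  pderiv i (jacobian f) z / jacobian f z

/-- The Schwarzian derivatives
`S^k_{ij} f = ∑_l ∂²f_l/∂z_i∂z_j · ∂z_k/∂f_l
  - (1/(n+1)) (δ^k_i ∂/∂z_j + δ^k_j ∂/∂z_i) log J_f`,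
where `∂z_k/∂f_l` are the entries of the inverse of the Jacobian matrix. -/
def schwarzian {n : ℕ} (f : (Fin n → ℂ) → (Fin n → ℂ)) (k i j : Fin n) (z : Fin n → ℂ) : ℂ :=
  (∑ l, pderiv i (pderiv j (fun w => f w l)) z * (jacobianMatrix f z)⁻¹ k l)
    - (1 / ((n : ℂ) + 1)) *
      ((if k = i then logJacobianDeriv f j z else 0)
        + (if k = j then logJacobianDeriv f i z else 0))

/-- The Schwarzian derivative operator: the `k`-th component of `S_f(z)(v)` is
`∑_{i,j} v_i S^k_{ij} f(z) v_j`. -/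
def schwarzianOp {n : ℕ} (f : (Fin n → ℂ) → (Fin n → ℂ)) (z v : Fin n → ℂ) : Fin n → ℂ :=
  fun k => ∑ i, ∑ j, v i * schwarzian f k i j z * v j

/-- The Bergman norm of the unit polydisk of a tangent vector `v` at `z`:
`(2 ∑_i |v_i|² / (1 - |z_i|²)²)^{1/2}`. -/
def bergmanNorm {n : ℕ} (z v : Fin n → ℂ) : ℝ :=
  Real.sqrt (2 * ∑ i, ‖v i‖ ^ 2 / (1 - ‖z i‖ ^ 2) ^ 2)

/-- `‖S_f(z)‖`, the supremum of the Bergman norm of `S_f(z)(v)` over Bergman unit vectors `v`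
at `z`, as an extended nonnegative real. -/
def schwarzianNormAt {n : ℕ} (f : (Fin n → ℂ) → (Fin n → ℂ)) (z : Fin n → ℂ) : ENNReal :=
  ⨆ (v : Fin n → ℂ) (_ : bergmanNorm z v = 1), ENNReal.ofReal (bergmanNorm z (schwarzianOp f z v))

/-- `‖S_f‖ = sup_{z ∈ Ω} ‖S_f(z)‖`, for a subset `Ω` of the unit polydisk. -/
def schwarzianNorm {n : ℕ} (Ω : Set (Fin n → ℂ)) (f : (Fin n → ℂ) → (Fin n → ℂ)) : ENNReal :=
  ⨆ z ∈ Ω, schwarzianNormAt f z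

/-- The class `F_{α,r}` in dimension `n`: maps locally biholomorphic on `|z|_∞ < r` with
`f(0) = 0`, `Df(0) = I` and `‖S_f‖ ≤ α` on `|z|_∞ < r` in the Bergman metric of the unit
polydisk. Only the values of `f` on `|z|_∞ < r` matter. -/
def enlargedClass (n : ℕ) (r α : ℝ) : Set ((Fin n → ℂ) → (Fin n → ℂ)) :=
  {f | IsLocallyBiholomorphicOn f (polydisk n r) ∧ f 0 = 0 ∧ jacobianMatrix f 0 = 1 ∧
    schwarzianNorm (polydisk n r) f ≤ ENNReal.ofReal α}

/-- The Euclidean norm `|∇J_f(0)|` of the complex gradient of the Jacobian at the origin. -/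
def gradJacobianNorm {n : ℕ} (f : (Fin n → ℂ) → (Fin n → ℂ)) : ℝ :=
  Real.sqrt (∑ i, ‖pderiv i (jacobian f) 0‖ ^ 2)

/-- The order `μ_r(α) = sup_{f ∈ F_{α,r}} |∇J_f(0)|`. -/
def order (n : ℕ) (r α : ℝ) : ℝ :=
  sSup (gradJacobianNorm '' enlargedClass n r α)

end PolydiskSchwarzian

end

/-! Finiteness. With `ψ_i = ∂_i log J_f/(n+1)`, the flat connection pulled back by `f` has
coefficients `Γ^k_ij = S^k_ij + δ^k_i ψ_j + δ^k_j ψ_i`. Its curvature vanishes, and for `n ≥ 2` this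
gives a Riccati system `∂_m ψ_j = ψ_m ψ_j + ∑_p ψ_p S^p_mj + Q` whose `Q` involves only `S` and its
first derivatives (`pderiv_normalizedLogDeriv`). Both are bounded near the origin, by `α` and
Cauchy's estimate. Along a complex disk the functions `u = J_f^{-1/(n+1)}` (normalized at the
centre) and `U_a = -ψ_a u` solve a linear system with bounded coefficients. Since `u` has no zero,
its initial slope cannot be too large: otherwise `u` would be nearly linear with large slope on a
small disk, against the maximum principle for `1/u` (`norm_initial_le_of_linear_system`).

Growth. The dilation `f(tz)/t` multiplies the gradient by `t` and the Schwarzian bound by at most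
`t(1-t²r²)/(1-r²)`, so `t μ(α) ≤ μ(α t(1-t²r²)/(1-r²))` (`mul_order_le`). Solving for `t` turns this
into a one-sided difference estimate (`order_sub_le`). With monotonicity it yields the Lipschitz
property, and through left difference quotients the differential inequality. -/

open Filter Topology

namespace PolydiskSchwarzian

/-! ### Calculus of complex partial derivatives. -/

section PartialDerivatives

variable {n : ℕ} {g h : (Fin n → ℂ) → ℂ} {z : Fin n → ℂ}

theorem analyticAt_pderiv (hg : AnalyticAt ℂ g z) (i : Fin n) : AnalyticAt ℂ (pderiv i g) z :=
  (ContinuousLinearMap.analyticAt (ContinuousLinearMap.apply ℂ ℂ (Pi.single i 1 : Fin n → ℂ))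
    (fderiv ℂ g z)).comp hg.fderiv

theorem pderiv_comm (hg : AnalyticAt ℂ g z) (i j : Fin n) :
    pderiv i (pderiv j g) z = pderiv j (pderiv i g) z := by
  have hd : DifferentiableAt ℂ (fderiv ℂ g) z := hg.fderiv.differentiableAt
  have key : ∀ a b : Fin n, pderiv a (pderiv b g) z =
      fderiv ℂ (fderiv ℂ g) z (Pi.single a 1) (Pi.single b 1) := by
    intro a b
    unfold pderiv
    rw [fderiv_clm_apply hd (differentiableAt_const _)]
    simp
  rw [key, key]
  exact (hg.contDiffAt (n := ⊤)).isSymmSndFDerivAt_of_omega _ _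

theorem pderiv_congr (hgh : g =ᶠ[𝓝 z] h) (i : Fin n) : pderiv i g z = pderiv i h z := by
  rw [pderiv, hgh.fderiv_eq, pderiv]

theorem pderiv_add (hg : AnalyticAt ℂ g z) (hh : AnalyticAt ℂ h z) (i : Fin n) :
    pderiv i (fun w => g w + h w) z = pderiv i g z + pderiv i h z := by
  simp [pderiv, fderiv_fun_add hg.differentiableAt hh.differentiableAt]

theorem pderiv_mul (hg : AnalyticAt ℂ g z) (hh : AnalyticAt ℂ h z) (i : Fin n) :
    pderiv i (fun w => g w * h w) z = pderiv i g z * h z + g z * pderiv i h z := by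
  simp [pderiv, fderiv_fun_mul hg.differentiableAt hh.differentiableAt]
  ring

theorem pderiv_mul_const (hg : AnalyticAt ℂ g z) (c : ℂ) (i : Fin n) :
    pderiv i (fun w => g w * c) z = pderiv i g z * c := by
  rw [pderiv, fderiv_mul_const hg.differentiableAt]
  simp [pderiv, mul_comm]

theorem pderiv_sum {ι : Type*} (s : Finset ι) {F : ι → (Fin n → ℂ) → ℂ}
    (hF : ∀ a ∈ s, AnalyticAt ℂ (F a) z) (i : Fin n) :
    pderiv i (fun w => ∑ a ∈ s, F a w) z = ∑ a ∈ s, pderiv i (F a) z := by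
  simp [pderiv, fderiv_fun_sum fun a ha => (hF a ha).differentiableAt]

theorem pderiv_comp_smul (i : Fin n) (g : (Fin n → ℂ) → ℂ) (t : ℂ) (z : Fin n → ℂ) :
    pderiv i (fun w => g (t • w)) z = t * pderiv i g (t • z) := by
  simp [pderiv, fderiv_comp_smul]

theorem hasDerivAt_comp_line (hg : AnalyticAt ℂ g z) (i : Fin n) (a : Fin n → ℂ) (t : ℂ)
    (hz : a + t • (Pi.single i 1 : Fin n → ℂ) = z) :
    HasDerivAt (fun s : ℂ => g (a + s • (Pi.single i 1 : Fin n → ℂ))) (pderiv i g z) t := by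
  subst hz
  have h1 : HasDerivAt (fun s : ℂ => a + s • (Pi.single i 1 : Fin n → ℂ)) (Pi.single i 1) t := by
    simpa using ((hasDerivAt_id t).smul_const (Pi.single i 1 : Fin n → ℂ)).const_add a
  exact hg.differentiableAt.hasFDerivAt.comp_hasDerivAt t h1

end PartialDerivatives

/-! ### Analyticity of the Jacobian and of the inverse Jacobian matrix. -/

section Analyticity

variable {n : ℕ} {f : (Fin n → ℂ) → (Fin n → ℂ)} {z : Fin n → ℂ}

theorem analyticAt_component (hf : AnalyticAt ℂ f z) (l : Fin n) :
    AnalyticAt ℂ (fun w => f w l) z :=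
  (ContinuousLinearMap.analyticAt (ContinuousLinearMap.proj (R := ℂ) (φ := fun _ : Fin n => ℂ) l)
    (f z)).comp hf

theorem analyticAt_det {A : (Fin n → ℂ) → Matrix (Fin n) (Fin n) ℂ}
    (hA : ∀ i j, AnalyticAt ℂ (fun w => A w i j) z) : AnalyticAt ℂ (fun w => (A w).det) z := by
  simp only [Matrix.det_apply']
  exact Finset.analyticAt_fun_sum _ fun σ _ =>
    analyticAt_const.mul (Finset.analyticAt_fun_prod _ fun i _ => hA _ _)

theorem analyticAt_jacobianMatrix (hf : AnalyticAt ℂ f z) (l i : Fin n) :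
    AnalyticAt ℂ (fun w => jacobianMatrix f w l i) z :=
  analyticAt_pderiv (analyticAt_component hf l) i

theorem analyticAt_jacobian (hf : AnalyticAt ℂ f z) : AnalyticAt ℂ (jacobian f) z :=
  analyticAt_det (analyticAt_jacobianMatrix hf)

theorem analyticAt_jacobianMatrix_inv (hf : AnalyticAt ℂ f z) (hJ : jacobian f z ≠ 0)
    (k l : Fin n) : AnalyticAt ℂ (fun w => (jacobianMatrix f w)⁻¹ k l) z := by
  -- Cramer's rule.
  have : (fun w => (jacobianMatrix f w)⁻¹ k l) = fun w => (jacobian f w)⁻¹ *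
      ((jacobianMatrix f w).updateRow l (Pi.single k 1)).det := by
    ext w
    rw [Matrix.inv_def, Matrix.smul_apply, Matrix.adjugate_apply, Ring.inverse_eq_inv, smul_eq_mul,
      jacobian]
  rw [this]
  refine ((analyticAt_jacobian hf).inv hJ).mul (analyticAt_det fun i j => ?_)
  by_cases h : i = l
  · subst h
    simp only [Matrix.updateRow_self]
    exact analyticAt_const
  · simp only [Matrix.updateRow_ne h]
    exact analyticAt_jacobianMatrix hf i j

theorem analyticAt_logJacobianDeriv (hf : AnalyticAt ℂ f z) (hJ : jacobian f z ≠ 0) (i : Fin n) :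
    AnalyticAt ℂ (logJacobianDeriv f i) z :=
  (analyticAt_pderiv (analyticAt_jacobian hf) i).div (analyticAt_jacobian hf) hJ

end Analyticity

/-! ### Flatness of the pulled-back connection and the Riccati system. -/

section Riccati

variable {n : ℕ} {f : (Fin n → ℂ) → (Fin n → ℂ)} {z : Fin n → ℂ}

/-- The coefficients of the flat connection pulled back by `f`. -/
noncomputable def christoffel (f : (Fin n → ℂ) → (Fin n → ℂ)) (k i j : Fin n) (z : Fin n → ℂ) : ℂ :=
  ∑ l, pderiv i (pderiv j (fun w => f w l)) z * (jacobianMatrix f z)⁻¹ k l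

/-- The partial derivatives of `(log J_f) / (n + 1)`. -/
noncomputable def normalizedLogDeriv (f : (Fin n → ℂ) → (Fin n → ℂ)) (i : Fin n) (z : Fin n → ℂ) : ℂ :=
  logJacobianDeriv f i z * (1 / ((n : ℂ) + 1))

theorem christoffel_eq (f : (Fin n → ℂ) → (Fin n → ℂ)) (k i j : Fin n) (z : Fin n → ℂ) :
    christoffel f k i j z = schwarzian f k i j z +
      (normalizedLogDeriv f j z * (if k = i then 1 else 0) +
        normalizedLogDeriv f i z * (if k = j then 1 else 0)) := by
  unfold christoffel schwarzian normalizedLogDeriv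
  split_ifs <;> ring

theorem analyticAt_christoffel (hf : AnalyticAt ℂ f z) (hJ : jacobian f z ≠ 0) (k i j : Fin n) :
    AnalyticAt ℂ (christoffel f k i j) z :=
  Finset.analyticAt_fun_sum _ fun l _ =>
    (analyticAt_pderiv (analyticAt_pderiv (analyticAt_component hf l) j) i).mul
      (analyticAt_jacobianMatrix_inv hf hJ k l)

theorem analyticAt_normalizedLogDeriv (hf : AnalyticAt ℂ f z) (hJ : jacobian f z ≠ 0)
    (i : Fin n) : AnalyticAt ℂ (normalizedLogDeriv f i) z :=
  (analyticAt_logJacobianDeriv hf hJ i).mul analyticAt_const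

theorem analyticAt_schwarzian (hf : AnalyticAt ℂ f z) (hJ : jacobian f z ≠ 0) (k i j : Fin n) :
    AnalyticAt ℂ (schwarzian f k i j) z := by
  have : schwarzian f k i j = fun w => christoffel f k i j w -
      (normalizedLogDeriv f j w * (if k = i then 1 else 0) +
        normalizedLogDeriv f i w * (if k = j then 1 else 0)) := by
    ext w
    rw [christoffel_eq]
    ring
  rw [this]
  exact (analyticAt_christoffel hf hJ k i j).sub
    (((analyticAt_normalizedLogDeriv hf hJ j).mul analyticAt_const).add
      ((analyticAt_normalizedLogDeriv hf hJ i).mul analyticAt_const))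

theorem christoffel_symm (hf : AnalyticAt ℂ f z) (k i j : Fin n) :
    christoffel f k i j z = christoffel f k j i z := by
  unfold christoffel
  exact Finset.sum_congr rfl fun l _ => by rw [pderiv_comm (analyticAt_component hf l)]

theorem schwarzian_symm (hf : AnalyticAt ℂ f z) (k i j : Fin n) :
    schwarzian f k i j z = schwarzian f k j i z := by
  have h := christoffel_symm hf k i j
  rw [christoffel_eq, christoffel_eq] at h
  linear_combination h

/-- `ψ` is locally a gradient. No branch of the logarithm is chosen: the second derivatives of `J_f`
commute, and `∂_a J_f = (∂_a log J_f) J_f` lets `J_f` be cancelled. -/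
theorem pderiv_normalizedLogDeriv_symm (hf : AnalyticAt ℂ f z) (hJ : jacobian f z ≠ 0)
    (i j : Fin n) :
    pderiv i (normalizedLogDeriv f j) z = pderiv j (normalizedLogDeriv f i) z := by
  have hA := analyticAt_jacobian hf
  have hmul : ∀ a : Fin n, pderiv a (jacobian f) =ᶠ[𝓝 z]
      fun w => logJacobianDeriv f a w * jacobian f w := by
    intro a
    filter_upwards [hA.continuousAt.eventually_ne hJ] with w hw
    rw [logJacobianDeriv, div_mul_cancel₀ _ hw]
  have hd : ∀ a b : Fin n, pderiv a (pderiv b (jacobian f)) z =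
      pderiv a (logJacobianDeriv f b) z * jacobian f z +
        logJacobianDeriv f b z * (logJacobianDeriv f a z * jacobian f z) := by
    intro a b
    rw [pderiv_congr (hmul b), pderiv_mul (analyticAt_logJacobianDeriv hf hJ b) hA,
      (hmul a).eq_of_nhds]
  have h := pderiv_comm hA i j
  rw [hd, hd] at h
  unfold normalizedLogDeriv
  rw [pderiv_mul_const (analyticAt_logJacobianDeriv hf hJ j),
    pderiv_mul_const (analyticAt_logJacobianDeriv hf hJ i)]
  congr 1
  apply mul_right_cancel₀ hJ
  linear_combination h

theorem sum_jacobianMatrix_mul_christoffel (hJ : jacobian f z ≠ 0) (l i j : Fin n) :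
    ∑ k, jacobianMatrix f z l k * christoffel f k i j z =
      pderiv i (pderiv j (fun w => f w l)) z := by
  have hu : IsUnit (jacobianMatrix f z).det := isUnit_iff_ne_zero.mpr hJ
  have h1 : (fun k => christoffel f k i j z) =
      ((jacobianMatrix f z)⁻¹).mulVec fun l => pderiv i (pderiv j (fun w => f w l)) z := by
    ext k
    simp only [christoffel, Matrix.mulVec, dotProduct, mul_comm]
  have h2 := congrFun (congrArg (jacobianMatrix f z).mulVec h1) l
  rw [Matrix.mulVec_mulVec, Matrix.mul_nonsing_inv _ hu, Matrix.one_mulVec] at h2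
  exact h2

/-- The connection pulled back by `f` has vanishing curvature. -/
theorem christoffel_flat (hf : AnalyticAt ℂ f z) (hJ : jacobian f z ≠ 0) (k m i j : Fin n) :
    pderiv m (christoffel f k i j) z + ∑ p, christoffel f k m p z * christoffel f p i j z =
      pderiv i (christoffel f k m j) z +
        ∑ p, christoffel f k i p z * christoffel f p m j z := by
  have hC := analyticAt_christoffel hf hJ
  -- Differentiating `∂_b∂_j f_l = ∑ (Df)_lp Γ^p_bj` once more expresses third derivatives through
  -- `Γ`. They commute, and `Df` is injective, so the two sides of the flatness identity agree.
  have key : ∀ a b l : Fin n, pderiv a (pderiv b (pderiv j (fun w => f w l))) z =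
      ∑ q, jacobianMatrix f z l q * (pderiv a (christoffel f q b j) z +
        ∑ p, christoffel f q a p z * christoffel f p b j z) := by
    intro a b l
    have hev : pderiv b (pderiv j (fun w => f w l)) =ᶠ[𝓝 z]
        fun w => ∑ p, jacobianMatrix f w l p * christoffel f p b j w := by
      filter_upwards [(analyticAt_jacobian hf).continuousAt.eventually_ne hJ] with w hw
      rw [sum_jacobianMatrix_mul_christoffel hw]
    rw [pderiv_congr hev, pderiv_sum _
      (F := fun p w => jacobianMatrix f w l p * christoffel f p b j w)
      fun p _ => (analyticAt_jacobianMatrix hf l p).mul (hC p b j)]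
    have hterm : ∀ p : Fin n,
        pderiv a (fun w => jacobianMatrix f w l p * christoffel f p b j w) z =
          (∑ q, jacobianMatrix f z l q * christoffel f q a p z) * christoffel f p b j z +
            jacobianMatrix f z l p * pderiv a (christoffel f p b j) z := by
      intro p
      rw [pderiv_mul (analyticAt_jacobianMatrix hf l p) (hC p b j),
        sum_jacobianMatrix_mul_christoffel hJ]
      rfl
    simp only [hterm, mul_add, Finset.sum_add_distrib, Finset.mul_sum, Finset.sum_mul]
    rw [add_comm, Finset.sum_comm]
    simp only [mul_assoc]
  have hinj := Matrix.mulVec_injective_of_det_ne_zero (M := jacobianMatrix f z) hJ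
  refine congrFun (@hinj
    (fun q => pderiv m (christoffel f q i j) z +
      ∑ p, christoffel f q m p z * christoffel f p i j z)
    (fun q => pderiv i (christoffel f q m j) z +
      ∑ p, christoffel f q i p z * christoffel f p m j z) ?_) k
  ext l
  simp only [Matrix.mulVec, dotProduct]
  rw [← key m i l, ← key i m l,
    pderiv_comm (analyticAt_pderiv (analyticAt_component hf l) j)]

/-- The zeroth order coefficient of the Riccati system, computed with an auxiliary index `k`. -/
noncomputable def riccatiCoeff (f : (Fin n → ℂ) → (Fin n → ℂ)) (k m j : Fin n) (z : Fin n → ℂ) : ℂ :=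
  pderiv k (schwarzian f k m j) z - pderiv m (schwarzian f k k j) z +
    (∑ p, schwarzian f k k p z * schwarzian f p m j z -
      ∑ p, schwarzian f k m p z * schwarzian f p k j z)

theorem pderiv_christoffel (hf : AnalyticAt ℂ f z) (hJ : jacobian f z ≠ 0) (a k i j : Fin n) :
    pderiv a (christoffel f k i j) z = pderiv a (schwarzian f k i j) z +
      (pderiv a (normalizedLogDeriv f j) z * (if k = i then 1 else 0) +
        pderiv a (normalizedLogDeriv f i) z * (if k = j then 1 else 0)) := by
  have hψ := analyticAt_normalizedLogDeriv hf hJ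
  have hm : ∀ (b : Fin n) (c : ℂ), AnalyticAt ℂ (fun w => normalizedLogDeriv f b w * c) z :=
    fun b c => (hψ b).mul analyticAt_const
  rw [funext (christoffel_eq f k i j), pderiv_add (analyticAt_schwarzian hf hJ k i j)
    (h := fun w => normalizedLogDeriv f j w * (if k = i then 1 else 0) +
      normalizedLogDeriv f i w * (if k = j then 1 else 0))
    ((hm j _).add (hm i _)), pderiv_add (hm j _) (hm i _),
    pderiv_mul_const (hψ j), pderiv_mul_const (hψ i)]

theorem sum_christoffel_mul_christoffel (f : (Fin n → ℂ) → (Fin n → ℂ)) (z : Fin n → ℂ)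
    (k a b j : Fin n) :
    ∑ p, christoffel f k a p z * christoffel f p b j z =
      ∑ p, schwarzian f k a p z * schwarzian f p b j z +
        normalizedLogDeriv f j z * schwarzian f k a b z +
        normalizedLogDeriv f b z * schwarzian f k a j z +
        normalizedLogDeriv f a z * christoffel f k b j z +
        (if k = a then 1 else 0) * (∑ p, normalizedLogDeriv f p z * schwarzian f p b j z +
          2 * (normalizedLogDeriv f b z * normalizedLogDeriv f j z)) := by
  have h1 : ∀ p, christoffel f k a p z * christoffel f p b j z =
      schwarzian f k a p z * schwarzian f p b j z +
      (if p = b then normalizedLogDeriv f j z * schwarzian f k a p z else 0) +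
      (if p = j then normalizedLogDeriv f b z * schwarzian f k a p z else 0) +
      (if k = p then normalizedLogDeriv f a z * christoffel f p b j z else 0) +
      ((if k = a then 1 else 0) * (normalizedLogDeriv f p z * schwarzian f p b j z) +
      (if p = b then (if k = a then 1 else 0) * (normalizedLogDeriv f p z *
        normalizedLogDeriv f j z) else 0) +
      (if p = j then (if k = a then 1 else 0) * (normalizedLogDeriv f p z *
        normalizedLogDeriv f b z) else 0)) := by
    intro p
    rw [christoffel_eq f k a p, christoffel_eq f p b j]
    split_ifs <;> ring
  simp only [h1, Finset.sum_add_distrib, Finset.sum_ite_eq', Finset.sum_ite_eq, Finset.mem_univ,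
    if_true, ← Finset.mul_sum]
  ring

/-- The Riccati system satisfied by the logarithmic derivatives of the Jacobian. -/
theorem pderiv_normalizedLogDeriv (hf : AnalyticAt ℂ f z) (hJ : jacobian f z ≠ 0)
    {k m : Fin n} (hkm : k ≠ m) (j : Fin n) :
    pderiv m (normalizedLogDeriv f j) z =
      normalizedLogDeriv f m z * normalizedLogDeriv f j z +
        ∑ p, normalizedLogDeriv f p z * schwarzian f p m j z + riccatiCoeff f k m j z := by
  -- With lower index `i = k ≠ m`, the left side contains `∂_m ψ_j` with coefficient 1. The
  -- remaining derivatives of `ψ`, present only if `k = j`, cancel by closedness of `ψ`.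
  have h := christoffel_flat hf hJ k m k j
  rw [pderiv_christoffel hf hJ, pderiv_christoffel hf hJ, sum_christoffel_mul_christoffel,
    sum_christoffel_mul_christoffel, if_neg hkm, if_pos rfl, christoffel_eq f k k j,
    christoffel_eq f k m j, if_pos rfl, if_neg hkm, schwarzian_symm hf k m k,
    pderiv_normalizedLogDeriv_symm hf hJ m k] at h
  rw [riccatiCoeff]
  linear_combination h

end Riccati

/-! ### Slope bound for zero-free solutions of linear systems. -/

section LinearSystem

/-- A nonvanishing solution of a linear system along a complex disk has bounded initial slope. -/
theorem norm_initial_le_of_linear_system {n : ℕ} (i : Fin n) {ρ C : ℝ} (hρ : 0 < ρ) (hC : 1 ≤ C)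
    {u : ℂ → ℂ} {U U' : ℂ → Fin n → ℂ}
    (hu : ∀ t ∈ Metric.ball (0 : ℂ) ρ, HasDerivAt u (U t i) t)
    (hU : ∀ t ∈ Metric.ball (0 : ℂ) ρ, HasDerivAt U (U' t) t)
    (hU' : ∀ t ∈ Metric.ball (0 : ℂ) ρ, ‖U' t‖ ≤ C * max ‖u t‖ ‖U t‖)
    (hne : ∀ t ∈ Metric.ball (0 : ℂ) ρ, u t ≠ 0) (hu0 : u 0 = 1) (hmax : ‖U 0‖ = ‖U 0 i‖) :
    ‖U 0‖ ≤ 3 / min (ρ / 2) (1 / (8 * C)) := by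
  have hC0 : 0 < C := by linarith
  -- `ρ/2` keeps the closed disk inside the domain; `1/(8C)` limits the oscillation of `u` and `U`
  -- on it to an eighth of their joint maximum `M`.
  set τ := min (ρ / 2) (1 / (8 * C)) with hτ
  have hτ0 : 0 < τ := lt_min (by positivity) (by positivity)
  have hτρ : τ < ρ := lt_of_le_of_lt (min_le_left _ _) (by linarith)
  have hCτ : C * τ ≤ 1 / 8 := by
    calc C * τ ≤ C * (1 / (8 * C)) := by gcongr; exact min_le_right _ _
      _ = 1 / 8 := by field_simp
  have hτ8 : τ ≤ 1 / 8 := by nlinarith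
  by_contra! hlt
  set N := ‖U 0‖ with hN
  have hNτ : 3 < N * τ := (div_lt_iff₀ hτ0).mp hlt
  have hN1 : 1 < N := by nlinarith
  have hsub : Metric.closedBall (0 : ℂ) τ ⊆ Metric.ball 0 ρ := Metric.closedBall_subset_ball hτρ
  have h0 : (0 : ℂ) ∈ Metric.closedBall (0 : ℂ) τ := Metric.mem_closedBall_self hτ0.le
  have hconv : Convex ℝ (Metric.closedBall (0 : ℂ) τ) := convex_closedBall _ _
  have hcont : ContinuousOn (fun t => max ‖u t‖ ‖U t‖) (Metric.closedBall (0 : ℂ) τ) :=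
    ContinuousOn.sup
      (fun t ht => (hu t (hsub ht)).continuousAt.norm.continuousWithinAt)
      (fun t ht => (hU t (hsub ht)).continuousAt.norm.continuousWithinAt)
  obtain ⟨s, hs, hsmax⟩ := (isCompact_closedBall (0 : ℂ) τ).exists_isMaxOn ⟨0, h0⟩ hcont
  set M := max ‖u s‖ ‖U s‖ with hM
  have hle : ∀ t ∈ Metric.closedBall (0 : ℂ) τ, max ‖u t‖ ‖U t‖ ≤ M := fun t ht => hsmax ht
  have hM0 : 0 ≤ M := le_trans (norm_nonneg _) (le_max_left _ _)
  have hτt : ∀ t ∈ Metric.closedBall (0 : ℂ) τ, ‖t - 0‖ ≤ τ := fun t ht => by simpa using ht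
  have hUdiff : ∀ t ∈ Metric.closedBall (0 : ℂ) τ, ‖U t - U 0‖ ≤ M / 8 := by
    intro t ht
    have := hconv.norm_image_sub_le_of_norm_hasDerivWithin_le (C := C * M)
      (fun x hx => (hU x (hsub hx)).hasDerivWithinAt)
      (fun x hx => (hU' x (hsub hx)).trans (by gcongr; exact hle x hx)) h0 ht
    calc ‖U t - U 0‖ ≤ C * M * ‖t - 0‖ := this
      _ ≤ C * M * τ := by gcongr; exact hτt t ht
      _ = C * τ * M := by ring
      _ ≤ 1 / 8 * M := by gcongr
      _ = M / 8 := by ring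
  have hudiff : ∀ t ∈ Metric.closedBall (0 : ℂ) τ, ‖u t - u 0‖ ≤ M / 8 := by
    intro t ht
    have := hconv.norm_image_sub_le_of_norm_hasDerivWithin_le (C := M)
      (fun x hx => (hu x (hsub hx)).hasDerivWithinAt)
      (fun x hx => (norm_le_pi_norm (U x) i).trans ((le_max_right _ _).trans (hle x hx))) h0 ht
    calc ‖u t - u 0‖ ≤ M * ‖t - 0‖ := this
      _ ≤ M * (1 / 8) := by gcongr; exact (hτt t ht).trans hτ8
      _ = M / 8 := by ring
  have hMN : M ≤ N + M / 8 := by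
    refine max_le ?_ ?_
    · have h1 := norm_sub_norm_le (u s) (u 0)
      have h2 := hudiff s hs
      rw [hu0, norm_one] at h1
      rw [hu0] at h2
      linarith
    · have h1 := norm_sub_norm_le (U s) (U 0)
      have h2 := hUdiff s hs
      linarith
  -- `M ≤ N + M/8` gives `M/8 ≤ N/7`, so `u` differs from `1 + U_i(0) t` by at most `Nτ/7`.
  have hlin : ∀ t ∈ Metric.closedBall (0 : ℂ) τ, ‖u t - 1 - U 0 i * t‖ ≤ N / 7 * τ := by
    intro t ht
    have := hconv.norm_image_sub_le_of_norm_hasDerivWithin_le (C := N / 7)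
      (f := fun x => u x - U 0 i * x) (f' := fun x => U x i - U 0 i)
      (fun x hx => ((hu x (hsub hx)).sub
        (by simpa using (hasDerivAt_id x).const_mul (U 0 i))).hasDerivWithinAt)
      (fun x hx => by
        have h1 : ‖U x i - U 0 i‖ ≤ ‖U x - U 0‖ := norm_le_pi_norm (U x - U 0) i
        have h2 := hUdiff x hx
        linarith) h0 ht
    calc ‖u t - 1 - U 0 i * t‖ = ‖(u t - U 0 i * t) - (u 0 - U 0 i * 0)‖ := by
          rw [hu0]; congr 1; ring
      _ ≤ N / 7 * ‖t - 0‖ := this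
      _ ≤ N / 7 * τ := by gcongr; exact hτt t ht
  have hdiff : DifferentiableOn ℂ (fun t => (u t)⁻¹) (Metric.closedBall (0 : ℂ) τ) := fun t ht =>
    ((hu t (hsub ht)).differentiableAt.inv (hne t (hsub ht))).differentiableWithinAt
  have hdc : DiffContOnCl ℂ (fun t => (u t)⁻¹) (Metric.ball (0 : ℂ) τ) := by
    apply DifferentiableOn.diffContOnCl
    rwa [closure_ball _ hτ0.ne']
  -- On `|t| = τ`, `|u| ≥ (6/7)Nτ - 1 ≥ 18/7 - 1 = 11/7`, while `1/u` equals 1 at the centre.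
  have hfin := Complex.norm_le_of_forall_mem_frontier_norm_le Metric.isBounded_ball hdc
    (C := 7 / 11) (z := 0) (fun t ht => by
      rw [frontier_ball _ hτ0.ne'] at ht
      have htn : ‖t‖ = τ := by simpa using ht
      have h1 := hlin t (Metric.sphere_subset_closedBall ht)
      have h2 : ‖U 0 i * t‖ = N * τ := by rw [norm_mul, htn, ← hmax]
      have h3 : ‖U 0 i * t‖ ≤ ‖u t‖ + 1 + ‖u t - 1 - U 0 i * t‖ := by
        calc ‖U 0 i * t‖ = ‖u t - 1 - (u t - 1 - U 0 i * t)‖ := by congr 1; ring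
          _ ≤ ‖u t - 1‖ + ‖u t - 1 - U 0 i * t‖ := norm_sub_le _ _
          _ ≤ ‖u t‖ + 1 + ‖u t - 1 - U 0 i * t‖ := by
            gcongr
            simpa using norm_sub_le (u t) 1
      have h4 : 11 / 7 ≤ ‖u t‖ := by linarith
      rw [norm_inv]
      calc ‖u t‖⁻¹ ≤ (11 / 7)⁻¹ := by gcongr
        _ = 7 / 11 := by norm_num)
    (subset_closure (Metric.mem_ball_self hτ0))
  rw [hu0] at hfin
  norm_num at hfin

end LinearSystem

/-! ### Bound for the logarithmic derivative of the Jacobian at the origin. -/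

section LogDerivBound

variable {n : ℕ} {f : (Fin n → ℂ) → (Fin n → ℂ)}

theorem single_mem_polydisk {ρ : ℝ} (i : Fin n) {t : ℂ} (ht : t ∈ Metric.ball (0 : ℂ) ρ) :
    (0 : Fin n → ℂ) + t • (Pi.single i 1 : Fin n → ℂ) ∈ polydisk n ρ := by
  have ht' : ‖t‖ < ρ := by simpa using ht
  intro j
  by_cases h : j = i
  · subst h; simpa using ht'
  · simpa [h] using (norm_nonneg t).trans_lt ht'

theorem norm_normalizedLogDeriv_zero_le {ρ M K : ℝ} (hρ : 0 < ρ) (hM : 0 ≤ M) (hK : 0 ≤ K)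
    (hf : IsLocallyBiholomorphicOn f (polydisk n ρ))
    (hS : ∀ z ∈ polydisk n ρ, ∀ k i j, ‖schwarzian f k i j z‖ ≤ M)
    (hQ : ∀ m : Fin n, ∃ k, k ≠ m ∧ ∀ z ∈ polydisk n ρ, ∀ j, ‖riccatiCoeff f k m j z‖ ≤ K)
    (j : Fin n) :
    ‖normalizedLogDeriv f j 0‖ ≤ 3 / min (ρ / 2) (1 / (8 * (n * M + K + 1))) := by
  -- The disk is taken in the direction of the largest `ψ_i(0)`, so that the slope of `u` controls
  -- all components.
  obtain ⟨i, -, hi⟩ := Finset.univ.exists_max_image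
    (fun j => ‖normalizedLogDeriv f j 0‖) ⟨j, Finset.mem_univ j⟩
  obtain ⟨k, hki, hQk⟩ := hQ i
  set line : ℂ → Fin n → ℂ := fun t => 0 + t • (Pi.single i 1 : Fin n → ℂ) with hline
  set B := Metric.ball (0 : ℂ) ρ with hB
  have hmem : ∀ t ∈ B, line t ∈ polydisk n ρ := fun t ht => single_mem_polydisk i ht
  have hψ : ∀ (a : Fin n), ∀ t ∈ B, HasDerivAt (fun s => normalizedLogDeriv f a (line s))
      (pderiv i (normalizedLogDeriv f a) (line t)) t := fun a t ht =>
    hasDerivAt_comp_line (analyticAt_normalizedLogDeriv (hf.1 _ (hmem t ht))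
      (hf.2 _ (hmem t ht)) a) i 0 t rfl
  -- A primitive of `ψ_i` along the disk defines `u` as an exponential, hence without zeros.
  obtain ⟨G₀, hG₀⟩ := DifferentiableOn.isExactOn_ball (c := 0) (r := ρ)
    (f := fun t => normalizedLogDeriv f i (line t))
    fun t ht => (hψ i t ht).differentiableAt.differentiableWithinAt
  set u : ℂ → ℂ := fun t => Complex.exp (G₀ 0 - G₀ t) with hu
  set U : ℂ → Fin n → ℂ := fun t a => -(normalizedLogDeriv f a (line t) * u t) with hU
  have hderu : ∀ t ∈ B, HasDerivAt u (U t i) t := by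
    intro t ht
    have := ((hG₀ t ht).const_sub (G₀ 0)).cexp
    refine this.congr_deriv ?_
    simp only [hU, hu]
    ring
  -- The quadratic term `ψ_i ψ_a` of the Riccati equation cancels against the derivative of `u`,
  -- leaving a linear system.
  set U' : ℂ → Fin n → ℂ := fun t a =>
    ∑ p, U t p * schwarzian f p i a (line t) - riccatiCoeff f k i a (line t) * u t with hU'
  have hderU : ∀ t ∈ B, HasDerivAt U (U' t) t := by
    intro t ht
    rw [hasDerivAt_pi]
    intro a
    have := ((hψ a t ht).mul (hderu t ht)).neg
    refine HasDerivAt.congr_deriv this ?_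
    rw [pderiv_normalizedLogDeriv (hf.1 _ (hmem t ht)) (hf.2 _ (hmem t ht)) hki]
    simp only [hU', hU, add_mul, Finset.sum_mul]
    have : ∀ p, -(normalizedLogDeriv f p (line t) * u t) * schwarzian f p i a (line t) =
      -(normalizedLogDeriv f p (line t) * schwarzian f p i a (line t) * u t) := fun p => by ring
    simp only [this, Finset.sum_neg_distrib]
    ring
  have hboundU : ∀ t ∈ B, ‖U' t‖ ≤ (n * M + K + 1) * max ‖u t‖ ‖U t‖ := by
    intro t ht
    have hm0 : 0 ≤ max ‖u t‖ ‖U t‖ := (norm_nonneg _).trans (le_max_left _ _)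
    rw [pi_norm_le_iff_of_nonneg (by positivity)]
    intro a
    calc ‖U' t a‖ ≤ ‖∑ p, U t p * schwarzian f p i a (line t)‖ +
          ‖riccatiCoeff f k i a (line t) * u t‖ := norm_sub_le _ _
      _ ≤ ∑ p : Fin n, max ‖u t‖ ‖U t‖ * M + K * max ‖u t‖ ‖U t‖ := by
        refine add_le_add ((norm_sum_le _ _).trans (Finset.sum_le_sum fun p _ => ?_)) ?_
        · rw [norm_mul]
          exact mul_le_mul ((norm_le_pi_norm (U t) p).trans (le_max_right _ _))
            (hS _ (hmem t ht) p i a) (norm_nonneg _) hm0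
        · rw [norm_mul]
          exact mul_le_mul (hQk _ (hmem t ht) a) (le_max_left _ _) (norm_nonneg _) hK
      _ = (n * M + K) * max ‖u t‖ ‖U t‖ := by
        simp only [Finset.sum_const, Finset.card_univ, Fintype.card_fin, nsmul_eq_mul]
        ring
      _ ≤ (n * M + K + 1) * max ‖u t‖ ‖U t‖ :=
        mul_le_mul_of_nonneg_right (by linarith) hm0
  have hu0 : u 0 = 1 := by simp [hu]
  have hU0 : ∀ a, U 0 a = -normalizedLogDeriv f a 0 := by
    intro a
    simp [hU, hu0, hline]
  have hmax : ‖U 0‖ = ‖U 0 i‖ := by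
    refine le_antisymm ?_ (norm_le_pi_norm _ _)
    rw [pi_norm_le_iff_of_nonneg (norm_nonneg _)]
    intro a
    rw [hU0, hU0, norm_neg, norm_neg]
    exact hi a (Finset.mem_univ a)
  have hC : (1 : ℝ) ≤ n * M + K + 1 := by
    have : (0 : ℝ) ≤ n * M := by positivity
    linarith
  have hfin := norm_initial_le_of_linear_system i hρ hC hderu hderU hboundU
    (fun t _ => Complex.exp_ne_zero _) hu0 hmax
  calc ‖normalizedLogDeriv f j 0‖ = ‖U 0 j‖ := by rw [hU0, norm_neg]
    _ ≤ ‖U 0‖ := norm_le_pi_norm _ _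
    _ ≤ _ := hfin

/-- Cauchy's estimate on the disk of radius `r/2` about `z` in the `i`-th direction. -/
theorem norm_pderiv_le {g : (Fin n → ℂ) → ℂ} {r M : ℝ} (hr : 0 < r)
    (hg : AnalyticOnNhd ℂ g (polydisk n r)) (hM : ∀ z ∈ polydisk n r, ‖g z‖ ≤ M)
    {z : Fin n → ℂ} (hz : z ∈ polydisk n (r / 2)) (i : Fin n) :
    ‖pderiv i g z‖ ≤ M / (r / 2) := by
  have hmem : ∀ t ∈ Metric.closedBall (0 : ℂ) (r / 2),
      z + t • (Pi.single i 1 : Fin n → ℂ) ∈ polydisk n r := by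
    intro t ht j
    have ht' : ‖t‖ ≤ r / 2 := by simpa using ht
    have h1 : ‖(t • (Pi.single i 1 : Fin n → ℂ)) j‖ ≤ r / 2 := by
      by_cases h : j = i
      · subst h; simpa using ht'
      · simpa [h] using (half_pos hr).le
    calc ‖(z + t • (Pi.single i 1 : Fin n → ℂ)) j‖ ≤ ‖z j‖ + _ := norm_add_le _ _
      _ < r / 2 + r / 2 := add_lt_add_of_lt_of_le (hz j) h1
      _ = r := by ring
  have hd : ∀ t ∈ Metric.closedBall (0 : ℂ) (r / 2),
      HasDerivAt (fun s : ℂ => g (z + s • (Pi.single i 1 : Fin n → ℂ)))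
        (pderiv i g (z + t • (Pi.single i 1 : Fin n → ℂ))) t := fun t ht =>
    hasDerivAt_comp_line (hg _ (hmem t ht)) i z t rfl
  have h0 := hd 0 (Metric.mem_closedBall_self (by linarith))
  have hdc : DiffContOnCl ℂ (fun s : ℂ => g (z + s • (Pi.single i 1 : Fin n → ℂ)))
      (Metric.ball 0 (r / 2)) := by
    apply DifferentiableOn.diffContOnCl
    rw [closure_ball _ (by positivity)]
    exact fun t ht => (hd t ht).differentiableAt.differentiableWithinAt
  have := Complex.norm_deriv_le_of_forall_mem_sphere_norm_le (by positivity) hdc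
    fun t ht => hM _ (hmem t (Metric.sphere_subset_closedBall ht))
  rw [h0.deriv] at this
  simpa using this

theorem norm_riccatiCoeff_le {r M : ℝ} (hr : 0 < r)
    (hf : IsLocallyBiholomorphicOn f (polydisk n r))
    (hS : ∀ z ∈ polydisk n r, ∀ k i j, ‖schwarzian f k i j z‖ ≤ M)
    {z : Fin n → ℂ} (hz : z ∈ polydisk n (r / 2)) (k m j : Fin n) :
    ‖riccatiCoeff f k m j z‖ ≤ 2 * (M / (r / 2)) + 2 * (n * (M * M)) := by
  have hz' : z ∈ polydisk n r := fun l => (hz l).trans (by linarith)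
  have hA : ∀ a b c, AnalyticOnNhd ℂ (schwarzian f a b c) (polydisk n r) := fun a b c w hw =>
    analyticAt_schwarzian (hf.1 w hw) (hf.2 w hw) a b c
  have h1 : ∀ d a b c, ‖pderiv d (schwarzian f a b c) z‖ ≤ M / (r / 2) := fun d a b c =>
    norm_pderiv_le hr (hA a b c) (fun w hw => hS w hw a b c) hz d
  have h2 : ∀ a b c d : Fin n,
      ‖∑ p, schwarzian f a b p z * schwarzian f p c d z‖ ≤ n * (M * M) := by
    intro a b c d
    calc _ ≤ ∑ p : Fin n, M * M := by
          refine (norm_sum_le _ _).trans (Finset.sum_le_sum fun p _ => ?_)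
          rw [norm_mul]
          exact mul_le_mul (hS z hz' _ _ _) (hS z hz' _ _ _) (norm_nonneg _)
            ((norm_nonneg _).trans (hS z hz' a b c))
      _ = n * (M * M) := by simp
  have h3 := norm_sub_le (pderiv k (schwarzian f k m j) z) (pderiv m (schwarzian f k k j) z)
  have h4 := norm_sub_le (∑ p, schwarzian f k k p z * schwarzian f p m j z)
    (∑ p, schwarzian f k m p z * schwarzian f p k j z)
  have h5 := norm_add_le
    (pderiv k (schwarzian f k m j) z - pderiv m (schwarzian f k k j) z)
    (∑ p, schwarzian f k k p z * schwarzian f p m j z -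
      ∑ p, schwarzian f k m p z * schwarzian f p k j z)
  have h6 := h1 k k m j
  have h7 := h1 m k k j
  have h8 := h2 k k m j
  have h9 := h2 k m k j
  rw [riccatiCoeff]
  linarith

end LogDerivBound

/-! ### Bergman norm estimates and finiteness of the order. -/

section BergmanNorm

variable {n : ℕ} {f : (Fin n → ℂ) → (Fin n → ℂ)}

theorem bergmanNorm_smul (z v : Fin n → ℂ) (c : ℂ) :
    bergmanNorm z (c • v) = ‖c‖ * bergmanNorm z v := by
  unfold bergmanNorm
  rw [← Real.sqrt_sq (norm_nonneg c), ← Real.sqrt_mul (sq_nonneg _)]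
  congr 1
  simp only [Pi.smul_apply, smul_eq_mul, norm_mul, mul_pow, Finset.mul_sum]
  exact Finset.sum_congr rfl fun i _ => by ring

theorem bergmanNorm_nonneg (z v : Fin n → ℂ) : 0 ≤ bergmanNorm z v := Real.sqrt_nonneg _

theorem norm_le_bergmanNorm {z : Fin n → ℂ} (hz : z ∈ polydisk n 1) (v : Fin n → ℂ) (i : Fin n) :
    ‖v i‖ ≤ bergmanNorm z v := by
  have hi : ‖z i‖ ^ 2 < 1 := by
    have := hz i
    have := norm_nonneg (z i)
    nlinarith
  have h1 : ‖v i‖ ^ 2 ≤ ‖v i‖ ^ 2 / (1 - ‖z i‖ ^ 2) ^ 2 := by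
    rw [le_div_iff₀ (by nlinarith)]
    refine mul_le_of_le_one_right (sq_nonneg _) ?_
    exact pow_le_one₀ (by linarith) (by nlinarith [sq_nonneg ‖z i‖])
  have h2 : ‖v i‖ ^ 2 / (1 - ‖z i‖ ^ 2) ^ 2 ≤ ∑ i, ‖v i‖ ^ 2 / (1 - ‖z i‖ ^ 2) ^ 2 :=
    Finset.single_le_sum (f := fun i => ‖v i‖ ^ 2 / (1 - ‖z i‖ ^ 2) ^ 2)
      (fun j _ => by positivity) (Finset.mem_univ i)
  exact Real.le_sqrt_of_sq_le (by nlinarith [sq_nonneg ‖v i‖])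

theorem bergmanNorm_pos {z v : Fin n → ℂ} (hz : z ∈ polydisk n 1) (hv : v ≠ 0) :
    0 < bergmanNorm z v := by
  obtain ⟨i, hi⟩ := Function.ne_iff.mp hv
  exact (norm_pos_iff.mpr hi).trans_le (norm_le_bergmanNorm hz v i)

theorem bergmanNorm_zero (z : Fin n → ℂ) : bergmanNorm z 0 = 0 := by
  simp [bergmanNorm]

theorem schwarzianOp_smul (f : (Fin n → ℂ) → (Fin n → ℂ)) (z v : Fin n → ℂ) (c : ℂ) :
    schwarzianOp f z (c • v) = c ^ 2 • schwarzianOp f z v := by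
  ext k
  simp only [schwarzianOp, Pi.smul_apply, smul_eq_mul, Finset.mul_sum]
  exact Finset.sum_congr rfl fun i _ => Finset.sum_congr rfl fun j _ => by ring

/-- `S_f(z)` is quadratic in `v`, so the bound on unit vectors extends by scaling. Inside the unit
polydisk nonzero vectors have positive norm and can be normalized. -/
theorem schwarzianNorm_le_iff {Ω : Set (Fin n → ℂ)} (hΩ : Ω ⊆ polydisk n 1) {α : ℝ}
    (hα : 0 ≤ α) :
    schwarzianNorm Ω f ≤ ENNReal.ofReal α ↔
      ∀ z ∈ Ω, ∀ v, bergmanNorm z (schwarzianOp f z v) ≤ α * bergmanNorm z v ^ 2 := by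
  simp only [schwarzianNorm, schwarzianNormAt, iSup_le_iff, ENNReal.ofReal_le_ofReal_iff hα]
  refine forall₂_congr fun z hz => ⟨fun h v => ?_, fun h v hv => by simpa [hv] using h v⟩
  by_cases hv : v = 0
  · have : schwarzianOp f z 0 = 0 := by ext k; simp [schwarzianOp]
    simp [hv, this, bergmanNorm_zero]
  have hN := bergmanNorm_pos (hΩ hz) hv
  set N := bergmanNorm z v with hNdef
  have hnorm : ‖((N : ℂ))⁻¹‖ = N⁻¹ := by
    rw [norm_inv, Complex.norm_real, Real.norm_of_nonneg hN.le]
  have h1 := h ((N : ℂ)⁻¹ • v) (by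
    rw [bergmanNorm_smul, hnorm, inv_mul_cancel₀ hN.ne'])
  rw [schwarzianOp_smul, bergmanNorm_smul, norm_pow, hnorm, inv_pow,
    inv_mul_le_iff₀ (by positivity)] at h1
  linarith

theorem bergmanNorm_le_of_norm_le {z v : Fin n → ℂ} {r c : ℝ} (hr : 0 < r) (hr1 : r < 1)
    (hz : z ∈ polydisk n r) (hv : ∀ i, ‖v i‖ ≤ c) :
    bergmanNorm z v ^ 2 ≤ 2 * (n * (c ^ 2 / (1 - r ^ 2) ^ 2)) := by
  unfold bergmanNorm
  rw [Real.sq_sqrt (by positivity)]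
  have hr2 : r ^ 2 < 1 := by nlinarith
  gcongr
  calc ∑ i, ‖v i‖ ^ 2 / (1 - ‖z i‖ ^ 2) ^ 2 ≤ ∑ i : Fin n, c ^ 2 / (1 - r ^ 2) ^ 2 := by
        refine Finset.sum_le_sum fun i _ => ?_
        have := (hz i).le
        have h1 : ‖z i‖ ^ 2 ≤ r ^ 2 := by gcongr
        have h2 : 0 < 1 - r ^ 2 := by linarith
        have := hv i
        gcongr
    _ = n * (c ^ 2 / (1 - r ^ 2) ^ 2) := by simp

theorem polydisk_mono {r s : ℝ} (h : r ≤ s) : polydisk n r ⊆ polydisk n s :=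
  fun _ hz i => (hz i).trans_le h

/-- Polarization: `2 S_ij = S(e_i + e_j) - S(e_i) - S(e_j)`. All three vectors have coordinates of
modulus at most 2, whence `2 ^ 2` and the factor 3. -/
theorem norm_schwarzian_le {r α : ℝ} (hr : 0 < r) (hr1 : r < 1) (hα : 0 ≤ α)
    (hf : AnalyticOnNhd ℂ f (polydisk n r))
    (hS : schwarzianNorm (polydisk n r) f ≤ ENNReal.ofReal α)
    {z : Fin n → ℂ} (hz : z ∈ polydisk n r) (k i j : Fin n) :
    ‖schwarzian f k i j z‖ ≤ 3 * (α * (2 * (n * (2 ^ 2 / (1 - r ^ 2) ^ 2)))) := by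
  have hz1 := polydisk_mono hr1.le hz
  rw [schwarzianNorm_le_iff (polydisk_mono hr1.le) hα] at hS
  have hop : ∀ v : Fin n → ℂ, (∀ i, ‖v i‖ ≤ 2) →
      ‖schwarzianOp f z v k‖ ≤ α * (2 * (n * (2 ^ 2 / (1 - r ^ 2) ^ 2))) := fun v hv =>
    (norm_le_bergmanNorm hz1 _ k).trans ((hS z hz v).trans
      (mul_le_mul_of_nonneg_left (bergmanNorm_le_of_norm_le hr hr1 hz hv) hα))
  have hsingle : ∀ a b : Fin n, ‖(Pi.single a 1 : Fin n → ℂ) b‖ ≤ 1 := by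
    intro a b
    by_cases h : b = a
    · subst h; simp
    · simp [h]
  have hexp : ∀ v w : Fin n → ℂ, schwarzianOp f z (v + w) k = schwarzianOp f z v k +
      schwarzianOp f z w k + ((∑ a, ∑ b, v a * schwarzian f k a b z * w b) +
        ∑ a, ∑ b, w a * schwarzian f k a b z * v b) := by
    intro v w
    simp only [schwarzianOp, Pi.add_apply, ← Finset.sum_add_distrib]
    exact Finset.sum_congr rfl fun a _ => Finset.sum_congr rfl fun b _ => by ring
  have hbil : ∀ a b : Fin n, ∑ c, ∑ d, (Pi.single a 1 : Fin n → ℂ) c * schwarzian f k c d z *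
      (Pi.single b 1 : Fin n → ℂ) d = schwarzian f k a b z := by
    intro a b
    simp [Pi.single_apply]
  have h := hexp (Pi.single i 1) (Pi.single j 1)
  rw [hbil, hbil, schwarzian_symm (hf z hz) k j i] at h
  have h1 := hop (Pi.single i 1 + Pi.single j 1) fun a =>
    (norm_add_le _ _).trans (by linarith [hsingle i a, hsingle j a])
  have h2 := hop (Pi.single i 1) fun a => (hsingle i a).trans one_le_two
  have h3 := hop (Pi.single j 1) fun a => (hsingle j a).trans one_le_two
  have h4 : 2 * schwarzian f k i j z = schwarzianOp f z (Pi.single i 1 + Pi.single j 1) k -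
      schwarzianOp f z (Pi.single i 1) k - schwarzianOp f z (Pi.single j 1) k := by
    rw [h]; ring
  have h5 : ‖2 * schwarzian f k i j z‖ ≤ ‖schwarzianOp f z (Pi.single i 1 + Pi.single j 1) k‖ +
      ‖schwarzianOp f z (Pi.single i 1) k‖ + ‖schwarzianOp f z (Pi.single j 1) k‖ := by
    rw [h4]
    exact (norm_sub_le _ _).trans (add_le_add_left (norm_sub_le _ _) _)
  rw [norm_mul, Complex.norm_two] at h5
  linarith [norm_nonneg (schwarzian f k i j z)]

theorem pderiv_jacobian_zero (hJ : jacobianMatrix f 0 = 1) (i : Fin n) :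
    pderiv i (jacobian f) 0 = (n + 1) * normalizedLogDeriv f i 0 := by
  have h1 : jacobian f 0 = 1 := by rw [jacobian, hJ, Matrix.det_one]
  have h2 : (n : ℂ) + 1 ≠ 0 := Nat.cast_add_one_ne_zero n
  rw [normalizedLogDeriv, logJacobianDeriv, h1]
  field_simp

theorem bddAbove_gradJacobianNorm (hn : 2 ≤ n) {r α : ℝ} (hr : 0 < r) (hr1 : r < 1)
    (hα : 0 ≤ α) : BddAbove (gradJacobianNorm '' enlargedClass n r α) := by
  have : Nontrivial (Fin n) := Fin.nontrivial_iff_two_le.mpr hn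
  set M := 3 * (α * (2 * (n * (2 ^ 2 / (1 - r ^ 2) ^ 2)))) with hM
  have hM0 : 0 ≤ M := by positivity
  set K := 2 * (M / (r / 2)) + 2 * (n * (M * M)) with hK
  have hK0 : 0 ≤ K := by positivity
  -- Cauchy's estimate costs half the radius, so the linear system is used on a disk of radius
  -- `r/2`.
  set D := 3 / min (r / 2 / 2) (1 / (8 * (n * M + K + 1))) with hD
  refine ⟨Real.sqrt (∑ _i : Fin n, ((n + 1) * D) ^ 2), ?_⟩
  rintro _ ⟨f, ⟨hf, -, hJ, hS⟩, rfl⟩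
  have hsub : polydisk n (r / 2) ⊆ polydisk n r := polydisk_mono (by linarith)
  have hSM : ∀ z ∈ polydisk n r, ∀ k i j, ‖schwarzian f k i j z‖ ≤ M := fun z hz =>
    norm_schwarzian_le hr hr1 hα hf.1 hS hz
  have hψ := norm_normalizedLogDeriv_zero_le (ρ := r / 2) (by positivity) hM0 hK0
    ⟨hf.1.mono hsub, fun z hz => hf.2 z (hsub hz)⟩ (fun z hz => hSM z (hsub hz))
    fun m => (exists_ne m).imp fun k hk =>
      ⟨hk, fun z hz j => norm_riccatiCoeff_le hr hf hSM hz k m j⟩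
  refine Real.sqrt_le_sqrt (Finset.sum_le_sum fun i _ => ?_)
  rw [pderiv_jacobian_zero hJ, norm_mul]
  have h1 : ‖(n : ℂ) + 1‖ = n + 1 := by exact_mod_cast Complex.norm_natCast (n + 1)
  rw [h1]
  have := hψ i
  gcongr

end BergmanNorm

/-! ### Effect of dilations on the Schwarzian and the Bergman norm. -/

section Scaling

variable {n : ℕ} {f : (Fin n → ℂ) → (Fin n → ℂ)}

/-- The dilation `z ↦ f (t z) / t`. -/
noncomputable def dilation (f : (Fin n → ℂ) → (Fin n → ℂ)) (t : ℝ) (z : Fin n → ℂ) : Fin n → ℂ :=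
  (t : ℂ)⁻¹ • f ((t : ℂ) • z)

theorem pderiv_dilation {t : ℝ} (ht : t ≠ 0) (i l : Fin n) (z : Fin n → ℂ) :
    pderiv i (fun w => dilation f t w l) z = pderiv i (fun w => f w l) ((t : ℂ) • z) := by
  have ht' : (t : ℂ) ≠ 0 := Complex.ofReal_ne_zero.mpr ht
  have h1 : (fun w => dilation f t w l) = (t : ℂ)⁻¹ • fun w => f ((t : ℂ) • w) l := by
    ext w; simp [dilation]
  have h2 := pderiv_comp_smul i (fun w => f w l) t z
  rw [pderiv] at h2
  rw [h1, pderiv, fderiv_const_smul_field, Pi.smul_apply, smul_apply, h2, smul_eq_mul,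
    inv_mul_cancel_left₀ ht']

theorem jacobianMatrix_dilation {t : ℝ} (ht : t ≠ 0) (z : Fin n → ℂ) :
    jacobianMatrix (dilation f t) z = jacobianMatrix f ((t : ℂ) • z) := by
  ext l i
  exact pderiv_dilation ht i l z

theorem pderiv_jacobian_dilation {t : ℝ} (ht : t ≠ 0) (i : Fin n) (z : Fin n → ℂ) :
    pderiv i (jacobian (dilation f t)) z = t * pderiv i (jacobian f) ((t : ℂ) • z) := by
  rw [← pderiv_comp_smul]
  congr 1
  ext w
  rw [jacobian, jacobianMatrix_dilation ht, jacobian]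

theorem schwarzian_dilation {t : ℝ} (ht : t ≠ 0) (k i j : Fin n) (z : Fin n → ℂ) :
    schwarzian (dilation f t) k i j z = t * schwarzian f k i j ((t : ℂ) • z) := by
  have h1 : ∀ l, pderiv i (pderiv j fun w => dilation f t w l) z =
      t * pderiv i (pderiv j fun w => f w l) ((t : ℂ) • z) := by
    intro l
    rw [← pderiv_comp_smul]
    congr 1
    ext w
    exact pderiv_dilation ht j l w
  have h2 : ∀ a, logJacobianDeriv (dilation f t) a z =
      t * logJacobianDeriv f a ((t : ℂ) • z) := by
    intro a
    rw [logJacobianDeriv, pderiv_jacobian_dilation ht, jacobian, jacobianMatrix_dilation ht,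
      logJacobianDeriv, jacobian, mul_div_assoc]
  simp only [schwarzian, h1, h2, jacobianMatrix_dilation ht, mul_assoc, ← Finset.mul_sum]
  split_ifs <;> ring

theorem schwarzianOp_dilation {t : ℝ} (ht : t ≠ 0) (z v : Fin n → ℂ) :
    schwarzianOp (dilation f t) z v = (t : ℂ) • schwarzianOp f ((t : ℂ) • z) v := by
  ext k
  simp only [schwarzianOp, schwarzian_dilation ht, Pi.smul_apply, smul_eq_mul, Finset.mul_sum]
  exact Finset.sum_congr rfl fun i _ => Finset.sum_congr rfl fun j _ => by ring

theorem gradJacobianNorm_dilation {t : ℝ} (ht : 0 < t) :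
    gradJacobianNorm (dilation f t) = t * gradJacobianNorm f := by
  unfold gradJacobianNorm
  rw [← Real.sqrt_sq ht.le, ← Real.sqrt_mul (sq_nonneg _), Real.sqrt_sq ht.le, Finset.mul_sum]
  congr 1
  refine Finset.sum_congr rfl fun i _ => ?_
  rw [pderiv_jacobian_dilation ht.ne', smul_zero, norm_mul, mul_pow, Complex.norm_real,
    Real.norm_of_nonneg ht.le]

theorem norm_smul_le {t : ℝ} (ht : 0 < t) (ht1 : t ≤ 1) (z : Fin n → ℂ) (i : Fin n) :
    ‖((t : ℂ) • z) i‖ = t * ‖z i‖ ∧ t * ‖z i‖ ≤ ‖z i‖ := by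
  refine ⟨?_, mul_le_of_le_one_left (norm_nonneg _) ht1⟩
  rw [Pi.smul_apply, smul_eq_mul, norm_mul, Complex.norm_real, Real.norm_of_nonneg ht.le]

theorem smul_mem_polydisk {r t : ℝ} (ht : 0 < t) (ht1 : t ≤ 1) {z : Fin n → ℂ}
    (hz : z ∈ polydisk n r) : (t : ℂ) • z ∈ polydisk n r := fun i => by
  obtain ⟨h1, h2⟩ := norm_smul_le ht ht1 z i
  rw [h1]
  exact h2.trans_lt (hz i)

theorem bergmanNorm_smul_point_le {t : ℝ} (ht : 0 < t) (ht1 : t ≤ 1) {z : Fin n → ℂ}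
    (hz : z ∈ polydisk n 1) (v : Fin n → ℂ) :
    bergmanNorm ((t : ℂ) • z) v ≤ bergmanNorm z v := by
  refine Real.sqrt_le_sqrt (mul_le_mul_of_nonneg_left (Finset.sum_le_sum fun i _ => ?_)
    zero_le_two)
  obtain ⟨h1, h2⟩ := norm_smul_le ht ht1 z i
  have h3 : ‖z i‖ ^ 2 < 1 := pow_lt_one₀ (norm_nonneg _) (hz i) two_ne_zero
  rw [h1]
  have h4 : (t * ‖z i‖) ^ 2 ≤ ‖z i‖ ^ 2 := by gcongr
  have h5 : 0 < 1 - ‖z i‖ ^ 2 := by linarith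
  gcongr

/-- The ratio `(1 - t²x²)/(1 - x²)` increases with `x`, so its value at `x = r` bounds the change of
every weight. -/
theorem bergmanNorm_le_smul_point {r t : ℝ} (hr1 : r < 1) (ht : 0 < t) (ht1 : t ≤ 1)
    {z : Fin n → ℂ} (hr : 0 < r) (hz : z ∈ polydisk n r) (v : Fin n → ℂ) :
    bergmanNorm z v ≤ (1 - t ^ 2 * r ^ 2) / (1 - r ^ 2) * bergmanNorm ((t : ℂ) • z) v := by
  have hr2 : r ^ 2 < 1 := pow_lt_one₀ hr.le hr1 two_ne_zero
  have ht2 : t ^ 2 ≤ 1 := pow_le_one₀ ht.le ht1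
  have hb : 0 < 1 - r ^ 2 := by linarith
  have ha : 0 < 1 - t ^ 2 * r ^ 2 := by nlinarith
  set c := (1 - t ^ 2 * r ^ 2) / (1 - r ^ 2) with hc
  have hc0 : 0 < c := by positivity
  unfold bergmanNorm
  rw [← Real.sqrt_sq hc0.le, ← Real.sqrt_mul (sq_nonneg _)]
  refine Real.sqrt_le_sqrt ?_
  rw [mul_left_comm, Finset.mul_sum (Finset.univ : Finset (Fin n)) _ (c ^ 2)]
  refine mul_le_mul_of_nonneg_left (Finset.sum_le_sum fun i _ => ?_) zero_le_two
  obtain ⟨h1, h2⟩ := norm_smul_le ht ht1 z i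
  have h3 : ‖z i‖ ^ 2 < r ^ 2 := pow_lt_pow_left₀ (hz i) (norm_nonneg _) two_ne_zero
  have h4 : 0 < 1 - ‖z i‖ ^ 2 := by linarith
  have h5 : 0 < 1 - (t * ‖z i‖) ^ 2 := by rw [mul_pow]; nlinarith
  have h6 : 1 - (t * ‖z i‖) ^ 2 ≤ c * (1 - ‖z i‖ ^ 2) := by
    rw [hc, div_mul_eq_mul_div, le_div_iff₀ hb]
    nlinarith [mul_nonneg (sub_nonneg.mpr h3.le) (sub_nonneg.mpr ht2)]
  rw [h1, ← mul_div_assoc, div_le_div_iff₀ (by positivity) (by positivity)]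
  calc ‖v i‖ ^ 2 * (1 - (t * ‖z i‖) ^ 2) ^ 2 ≤ ‖v i‖ ^ 2 * (c * (1 - ‖z i‖ ^ 2)) ^ 2 := by gcongr
    _ = c ^ 2 * ‖v i‖ ^ 2 * (1 - ‖z i‖ ^ 2) ^ 2 := by ring

theorem dilation_mem_enlargedClass {r t α : ℝ} (hr : 0 < r) (hr1 : r < 1) (ht : 0 < t)
    (ht1 : t ≤ 1) (hα : 0 ≤ α) (hf : f ∈ enlargedClass n r α) :
    dilation f t ∈ enlargedClass n r (α * (t * ((1 - t ^ 2 * r ^ 2) / (1 - r ^ 2)))) := by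
  obtain ⟨⟨hA, hJ⟩, h0, h1, hS⟩ := hf
  have hr2 : r ^ 2 < 1 := pow_lt_one₀ hr.le hr1 two_ne_zero
  have ht2 : t ^ 2 ≤ 1 := pow_le_one₀ ht.le ht1
  have hc : 0 ≤ (1 - t ^ 2 * r ^ 2) / (1 - r ^ 2) := div_nonneg (by nlinarith) (by linarith)
  rw [schwarzianNorm_le_iff (polydisk_mono hr1.le) hα] at hS
  refine ⟨⟨fun z hz => ?_, fun z hz => ?_⟩, ?_, ?_, ?_⟩
  · have h2 : AnalyticAt ℂ (fun w : Fin n → ℂ => (t : ℂ) • w) z :=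
      analyticAt_const.fun_smul analyticAt_id
    exact (ContinuousLinearMap.analyticAt ((t : ℂ)⁻¹ • ContinuousLinearMap.id ℂ (Fin n → ℂ)) _).comp
      (AnalyticAt.fun_comp (hA _ (smul_mem_polydisk ht ht1 hz)) h2)
  · rw [jacobian, jacobianMatrix_dilation ht.ne']
    exact hJ _ (smul_mem_polydisk ht ht1 hz)
  · simp [dilation, h0]
  · rw [jacobianMatrix_dilation ht.ne', smul_zero, h1]
  · rw [schwarzianNorm_le_iff (polydisk_mono hr1.le) (by positivity)]
    intro z hz v
    rw [schwarzianOp_dilation ht.ne', bergmanNorm_smul, Complex.norm_real,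
      Real.norm_of_nonneg ht.le]
    calc t * bergmanNorm z (schwarzianOp f ((t : ℂ) • z) v)
        ≤ t * ((1 - t ^ 2 * r ^ 2) / (1 - r ^ 2) *
          bergmanNorm ((t : ℂ) • z) (schwarzianOp f ((t : ℂ) • z) v)) := by
          gcongr
          exact bergmanNorm_le_smul_point hr1 ht ht1 hr hz _
      _ ≤ t * ((1 - t ^ 2 * r ^ 2) / (1 - r ^ 2) * (α * bergmanNorm z v ^ 2)) := by
          gcongr
          refine (hS _ (smul_mem_polydisk ht ht1 hz) v).trans ?_
          gcongr
          · exact bergmanNorm_nonneg _ _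
          · exact bergmanNorm_smul_point_le ht ht1 (polydisk_mono hr1.le hz) v
      _ = _ := by ring

end Scaling

/-! ### Monotonicity, Lipschitz estimate and derivative of the order. -/

section Order

variable {n : ℕ}

theorem order_nonneg (n : ℕ) (r α : ℝ) : 0 ≤ order n r α :=
  Real.sSup_nonneg (by rintro _ ⟨f, -, rfl⟩; exact Real.sqrt_nonneg _)

theorem order_mono (hn : 2 ≤ n) {r α β : ℝ} (hr : 0 < r) (hr1 : r < 1) (hα : 0 ≤ α)
    (h : α ≤ β) : order n r α ≤ order n r β := by
  refine Real.sSup_le ?_ (order_nonneg n r β)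
  rintro _ ⟨f, ⟨hf, h0, h1, hS⟩, rfl⟩
  -- Boundedness is essential: the real supremum of an unbounded set is 0 by convention.
  exact le_csSup (bddAbove_gradJacobianNorm hn hr hr1 (hα.trans h))
    ⟨f, ⟨hf, h0, h1, hS.trans (ENNReal.ofReal_le_ofReal h)⟩, rfl⟩

theorem mul_order_le (hn : 2 ≤ n) {r t α : ℝ} (hr : 0 < r) (hr1 : r < 1) (ht : 0 < t)
    (ht1 : t ≤ 1) (hα : 0 ≤ α) :
    t * order n r α ≤ order n r (α * (t * ((1 - t ^ 2 * r ^ 2) / (1 - r ^ 2)))) := by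
  have hr2 : r ^ 2 < 1 := pow_lt_one₀ hr.le hr1 two_ne_zero
  have ht2 : t ^ 2 ≤ 1 := pow_le_one₀ ht.le ht1
  have hc : 0 ≤ (1 - t ^ 2 * r ^ 2) / (1 - r ^ 2) := div_nonneg (by nlinarith) (by linarith)
  rw [mul_comm, ← le_div_iff₀ ht]
  refine Real.sSup_le ?_ (div_nonneg (order_nonneg _ _ _) ht.le)
  rintro _ ⟨f, hf, rfl⟩
  rw [le_div_iff₀ ht, mul_comm, ← gradJacobianNorm_dilation ht]
  exact le_csSup (bddAbove_gradJacobianNorm hn hr hr1 (by positivity))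
    ⟨_, dilation_mem_enlargedClass hr hr1 ht ht1 hα hf, rfl⟩

theorem order_sub_le (hn : 2 ≤ n) {r α β : ℝ} (hr : 0 < r) (hr5 : r ^ 2 < 1 / 5) (hβ : 0 < β)
    (h : β ≤ α) :
    order n r α - order n r β ≤
      (1 - r ^ 2) / (1 - 5 * r ^ 2) * order n r α / α * (α - β) := by
  have hr1 : r < 1 := by nlinarith
  have hα : 0 < α := hβ.trans_le h
  have hb : 0 < 1 - r ^ 2 := by linarith
  have h5 : 0 < 1 - 5 * r ^ 2 := by linarith
  set φ : ℝ → ℝ := fun t => α * (t * ((1 - t ^ 2 * r ^ 2) / (1 - r ^ 2))) with hφ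
  have hcont : ContinuousOn φ (Set.Icc 0 1) := by fun_prop
  have hφ1 : φ 1 = α := by simp [hφ, hb.ne']
  -- `t` is chosen so that dilating the class for `α` lands in the class for `β`.
  obtain ⟨t, ⟨ht0, ht1⟩, htβ⟩ := intermediate_value_Icc zero_le_one hcont
    (show β ∈ Set.Icc (φ 0) (φ 1) by rw [hφ1]; exact ⟨by simpa [hφ] using hβ.le, h⟩)
  have htpos : 0 < t := lt_of_le_of_ne ht0 (by rintro rfl; simp [hφ] at htβ; linarith)
  have hmul := mul_order_le hn hr hr1 htpos ht1 hα.le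
  change t * order n r α ≤ order n r (φ t) at hmul
  rw [htβ] at hmul
  have hkey : 1 - t ≤ (1 - r ^ 2) / (1 - 5 * r ^ 2) / α * (α - β) := by
    rw [← htβ, div_div, div_mul_eq_mul_div, le_div_iff₀ (by positivity)]
    have : (1 - r ^ 2) * (α - φ t) = α * ((1 - r ^ 2) - t * (1 - t ^ 2 * r ^ 2)) := by
      simp only [hφ]
      field_simp
    rw [this]
    -- The difference of the two sides is `(1 - t) r² (4 - t - t²)`; on `[0, 1]` the last factor is
    -- at least 2.
    have h1 : (1 - t) * (1 - 5 * r ^ 2) ≤ (1 - r ^ 2) - t * (1 - t ^ 2 * r ^ 2) := by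
      have : 0 ≤ (1 - t) * r ^ 2 * (4 - t - t ^ 2) := by
        have : 0 ≤ 4 - t - t ^ 2 := by nlinarith
        have : 0 ≤ 1 - t := by linarith
        positivity
      linarith
    nlinarith
  have := mul_le_mul_of_nonneg_right hkey (order_nonneg n r α)
  calc order n r α - order n r β ≤ (1 - t) * order n r α := by linarith
    _ ≤ _ := this
    _ = _ := by ring

theorem locallyLipschitzOn_order (hn : 2 ≤ n) {r : ℝ} (hr : 0 < r) (hr5 : r ^ 2 < 1 / 5) :
    LocallyLipschitzOn (Set.Ioi (0 : ℝ)) (order n r) := by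
  intro a ha
  have ha0 : (0 : ℝ) < a := ha
  have hr1 : r < 1 := by nlinarith
  have hc : 0 ≤ (1 - r ^ 2) / (1 - 5 * r ^ 2) := div_nonneg (by linarith) (by linarith)
  -- On `(a/2, 2a)` monotonicity bounds `μ(x)/x` by `μ(2a)/(a/2)`.
  set L := (1 - r ^ 2) / (1 - 5 * r ^ 2) * order n r (2 * a) / (a / 2) with hL
  have hL0 : 0 ≤ L := by have := order_nonneg n r (2 * a); positivity
  refine ⟨L.toNNReal, Set.Ioo (a / 2) (2 * a),
    mem_nhdsWithin_of_mem_nhds (Ioo_mem_nhds (by linarith) (by linarith)), ?_⟩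
  have key : ∀ x ∈ Set.Ioo (a / 2) (2 * a), ∀ y ∈ Set.Ioo (a / 2) (2 * a), y ≤ x →
      |order n r x - order n r y| ≤ L * |x - y| := by
    intro x hx y hy hyx
    have hy0 : 0 < y := by linarith [hy.1]
    rw [abs_of_nonneg (sub_nonneg.mpr (order_mono hn hr hr1 hy0.le hyx)),
      abs_of_nonneg (sub_nonneg.mpr hyx)]
    refine (order_sub_le hn hr hr5 hy0 hyx).trans ?_
    have h1 := order_mono hn hr hr1 (hy0.trans_le hyx).le hx.2.le
    have h2 := order_nonneg n r (2 * a)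
    have h3 := hx.1.le
    have h4 := sub_nonneg.mpr hyx
    rw [hL]
    gcongr
  rw [lipschitzOnWith_iff_dist_le_mul]
  intro x hx y hy
  rw [Real.coe_toNNReal _ hL0, Real.dist_eq, Real.dist_eq]
  rcases le_total y x with h | h
  · exact key x hx y hy h
  · rw [abs_sub_comm, abs_sub_comm x y]
    exact key y hy x hx h

theorem mul_deriv_order_le (hn : 2 ≤ n) {r α m : ℝ} (hr : 0 < r) (hr5 : r ^ 2 < 1 / 5)
    (hα : 0 < α) (hm : HasDerivAt (order n r) m α) :
    α * m ≤ (1 - r ^ 2) / (1 - 5 * r ^ 2) * order n r α := by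
  -- Left difference quotients suffice, since `order_sub_le` carries the value at the larger
  -- argument.
  have hslope : Tendsto (slope (order n r) α) (𝓝[<] α) (𝓝 m) :=
    (hasDerivAt_iff_tendsto_slope_left_right.mp hm).1
  have hle : m ≤ (1 - r ^ 2) / (1 - 5 * r ^ 2) * order n r α / α := by
    refine le_of_tendsto hslope ?_
    filter_upwards [Ioo_mem_nhdsLT hα] with β hβ
    rw [slope_def_field, ← neg_div_neg_eq, neg_sub, neg_sub,
      div_le_iff₀ (sub_pos.mpr hβ.2)]
    exact order_sub_le hn hr hr5 hβ.1 hβ.2.le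
  rwa [le_div_iff₀ hα, mul_comm] at hle

end Order

end PolydiskSchwarzian

theorem theorem4p1 (n : ℕ) (hn : 2 ≤ n) (r : ℝ) (hr : 0 < r) (hr5 : r ^ 2 < 1 / 5) :
    (∀ α : ℝ, 0 < α → BddAbove
      (PolydiskSchwarzian.gradJacobianNorm '' PolydiskSchwarzian.enlargedClass n r α)) ∧
    LocallyLipschitzOn (Set.Ioi (0 : ℝ)) (PolydiskSchwarzian.order n r) ∧
    (∀ α : ℝ, 0 < α → ∀ m : ℝ, HasDerivAt (PolydiskSchwarzian.order n r) m α →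
      α * m ≤ (1 - r ^ 2) / (1 - 5 * r ^ 2) * PolydiskSchwarzian.order n r α) :=
  ⟨fun _ hα => PolydiskSchwarzian.bddAbove_gradJacobianNorm hn hr (by nlinarith) hα.le,
    PolydiskSchwarzian.locallyLipschitzOn_order hn hr hr5,
    fun _ hα _ hm => PolydiskSchwarzian.mul_deriv_order_le hn hr hr5 hα hm⟩
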